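/- Let $\Omega_+$ be either the open unit disc $\mathbb D$, with $\rho_\omega(\lambda)=1-\lambda\overline\omega$, or the open right half-plane $\{\lambda:\lambda+\overline\lambda>0\}$, with $\rho_\omega(\lambda)=2\pi(\lambda+\overline\omega)$, and let $\Omega_0$ be its boundary in $\mathbb C$. A kernel $\mathsf K_\omega(\lambda)$ on $D\times D$ with values in $\mathbb C^{m\times m}$ and $\mathsf K_\omega(\lambda)^*=\mathsf K_\lambda(\omega)$ has $\kappa$ negative squares if for all $n$, $\omega_1,\dots,\omega_n\in D$ and $u_1,\dots,u_n\in\mathbb C^m$ the Hermitian matrix $\big(u_k^*\mathsf K_{\omega_j}(\omega_k)u_j\big)_{j,k=1}^n$ has at most $\kappa$ negative eigenvalues (counted with multiplicity), and for some choice of these data exactly $\kappa$. For a matrix valued function $f$ meromorphic in $\Omega_+$, let $\mathfrak h_f^+\subseteq\Omega_+$ be its domain of holomorphy. Put $j_{pq}=\begin{bmatrix}I_p&0\\0&-I_q\end{bmatrix}$. * $\mathcal S_\kappa^{p\times q}$ is the class of $p\times q$ matrix valued functions $s$, meromorphic in $\Omega_+$, for which the kernel $\dfrac{I_p-s(\lambda)s(\omega)^*}{\rho_\omega(\lambda)}$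 has $\kappa$ negative squares on $\mathfrak h_s^+\times\mathfrak h_s^+$. * $\mathcal U_\kappa(j_{pq})$ is the class of $(p+q)\times(p+q)$ matrix valued functions $W$, meromorphic in $\Omega_+$, for which the kernel $\dfrac{j_{pq}-W(\lambda)j_{pq}W(\omega)^*}{\rho_\omega(\lambda)}$ has $\kappa$ negative squares on $\mathfrak h_W^+\times\mathfrak h_W^+$ and whose nontangential boundary values $W(\mu)$ exist and satisfy $j_{pq}-W(\mu)j_{pq}W(\mu)^*=0$ for a.e. $\mu\in\Omega_0$. * A $p\times(p+q)$ matrix valued function $X$, meromorphic in $\Omega_+$, is $(\Omega_+,j_{pq})_\kappa$-admissible if the kernel $\dfrac{X(\lambda)j_{pq}X(\omega)^*}{\rho_\omega(\lambda)}$ has $\kappa$ negative squares on $\mathfrak h_X^+\times\mathfrak h_X^+$. * For $W=\begin{bmatrix}w_{11}&w_{12}\\w_{21}&w_{22}\end{bmatrix}$, with $w_{11}$ of size $p\times p$ and $w_{22}$ of size $q\times q$, let $T_W[\varepsilon]=(w_{11}\varepsilon+w_{12})(w_{21}\varepsilon+w_{22})^{-1}$, and let $T_W[\mathcal S_\kappa^{p\times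 q}]$ be the set of the meromorphic functions $T_W[\varepsilon]$, where $\varepsilon\in\mathcal S_\kappa^{p\times q}$ and $w_{21}\varepsilon+w_{22}$ is invertible off a discrete subset of $\Omega_+$. **Theorem.** Let $\kappa_1\le\kappa$ be nonnegative integers, let $s\in\mathcal S_\kappa^{p\times q}$ and let $W\in\mathcal U_{\kappa_1}(j_{pq})$. Then $s\in T_W[\mathcal S_{\kappa-\kappa_1}^{p\times q}]$ if and only if $\begin{bmatrix}I_p&-s\end{bmatrix}W$ is $(\Omega_+,j_{pq})_{\kappa-\kappa_1}$-admissible. -/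

import Mathlib

open Filter Topology MeasureTheory
open scoped Matrix

noncomputable section

namespace GenSchur

/-- The two choices of the domain: the open unit disc and the open right half-plane. -/
inductive Region where
  | disk
  | halfPlane

namespace Region

/-- The open set `Ω₊`. -/
def carrier : Region → Set ℂ
  | disk => {z | ‖z‖ < 1}
  | halfPlane => {z | 0 < z.re}

/-- `ρ_ω(l)`, that is `1 - l * conj ω` for the disc and `2π (l + conj ω)` for the half-plane. -/
def rho : Region → ℂ → ℂ → ℂ
  | disk, ω, l => 1 - l * (starRingEnd ℂ) ω
  | halfPlane, ω, l => 2 * (Real.pi : ℂ) * (l + (starRingEnd ℂ) ω)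

/-- Parametrization of the boundary `Ω₀` by the real line: `t ↦ e^{it}`, respectively `t ↦ it`.
A property holds a.e. on `Ω₀` iff it holds at `bdryPoint t` for Lebesgue almost every `t`. -/
def bdryPoint : Region → ℝ → ℂ
  | disk, t => Complex.exp (t * Complex.I)
  | halfPlane, t => t * Complex.I

/-- Distance of a point of `Ω₊` to the boundary `Ω₀`. -/
def bdryDist : Region → ℂ → ℝ
  | disk, z => 1 - ‖z‖
  | halfPlane, z => z.re

/-- The nontangential approach region (Stolz angle) of aperture `M` at the boundary point `μ`. -/
def stolz (Ω : Region) (M : ℝ) (μ : ℂ) : Set ℂ :=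
  {z | z ∈ Ω.carrier ∧ ‖z - μ‖ < M * Ω.bdryDist z}

end Region

/-! Meromorphic matrix valued functions. They are represented by functions on `ℂ` with values in
matrices, two of them being regarded as equal on `Ω` if they agree off a discrete subset of `Ω`. -/

/-- All entries of `f` are meromorphic on `U`. -/
def MatMeromorphicOn {m n : Type*} (f : ℂ → Matrix m n ℂ) (U : Set ℂ) : Prop :=
  ∀ i j, MeromorphicOn (fun z => f z i j) U

/-- The canonical representative of a meromorphic matrix valued function on `U`: removable
singularities of the entries are removed (and entries get the value `0` at their poles). -/
def matNF {m n : Type*} (U : Set ℂ) (f : ℂ → Matrix m n ℂ) : ℂ → Matrix m n ℂ :=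
  fun z => Matrix.of fun i j => toMeromorphicNFOn (fun w => f w i j) U z

/-- The domain of holomorphy of the meromorphic matrix valued function `f` in `U`. -/
def holDomain {m n : Type*} (U : Set ℂ) (f : ℂ → Matrix m n ℂ) : Set ℂ :=
  {z | z ∈ U ∧ ∀ i j, AnalyticAt ℂ (fun w => matNF U f w i j) z}

/-- `L` is the nontangential limit of the meromorphic matrix valued function `f` on `Ω` at the
boundary point `μ`. -/
def HasNontangentialLimit {m n : Type*} (Ω : Region) (f : ℂ → Matrix m n ℂ) (μ : ℂ)
    (L : Matrix m n ℂ) : Prop :=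
  ∀ M : ℝ, 1 < M → ∀ i j,
    Tendsto (fun z => matNF Ω.carrier f z i j) (𝓝[Ω.stolz M μ] μ) (𝓝 (L i j))

/-! Kernels and their negative squares. The value `𝖪_ω(l)` of a kernel is written `K ω l`. -/

/-- The kernel `K` is Hermitian on `D`. -/
def IsHermitianKernel {m : Type*} (K : ℂ → ℂ → Matrix m m ℂ) (D : Set ℂ) : Prop :=
  ∀ ω ∈ D, ∀ l ∈ D, (K ω l)ᴴ = K l ω

/-- The matrix with the entries `⟨K_{ω_j}(ω_k) u_j, u_k⟩ = u_k^* K_{ω_j}(ω_k) u_j`. -/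
def kernelGram {m : Type*} [Fintype m] (K : ℂ → ℂ → Matrix m m ℂ) {n : ℕ}
    (ω : Fin n → ℂ) (u : Fin n → m → ℂ) : Matrix (Fin n) (Fin n) ℂ :=
  Matrix.of fun j k => star (u k) ⬝ᵥ (K (ω j) (ω k) *ᵥ u j)

theorem IsHermitianKernel.gram {m : Type*} [Fintype m] {K : ℂ → ℂ → Matrix m m ℂ} {D : Set ℂ}
    (hK : IsHermitianKernel K D) {n : ℕ} {ω : Fin n → ℂ} (hω : ∀ j, ω j ∈ D)
    (u : Fin n → m → ℂ) : (kernelGram K ω u).IsHermitian := by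
  ext j k
  simp only [Matrix.conjTranspose_apply, kernelGram, Matrix.of_apply]
  rw [← hK _ (hω k) _ (hω j), ← Matrix.star_dotProduct_star, star_star, Matrix.star_mulVec,
    dotProduct_comm, Matrix.dotProduct_mulVec]
  exact dotProduct_comm _ _

/-- The number of negative eigenvalues, counted with multiplicity, of a Hermitian matrix. -/
def negCount {n : ℕ} {A : Matrix (Fin n) (Fin n) ℂ} (hA : A.IsHermitian) : ℕ :=
  (Finset.univ.filter fun i => hA.eigenvalues i < 0).card

/-- `K` is a Hermitian kernel on `D` that has (exactly) `κ` negative squares. -/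
structure HasNegSquares {m : Type*} [Fintype m] (K : ℂ → ℂ → Matrix m m ℂ) (D : Set ℂ)
    (κ : ℕ) : Prop where
  hermitian : IsHermitianKernel K D
  le : ∀ (n : ℕ) (ω : Fin n → ℂ) (u : Fin n → m → ℂ) (hω : ∀ j, ω j ∈ D),
    negCount (hermitian.gram hω u) ≤ κ
  attained : ∃ (n : ℕ) (ω : Fin n → ℂ) (u : Fin n → m → ℂ) (hω : ∀ j, ω j ∈ D),
    negCount (hermitian.gram hω u) = κ

/-! The classes of matrix valued functions. -/

/-- The kernel `(I - s(l) s(ω)^*) / ρ_ω(l)`. -/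
def schurKernel {p q : ℕ} (Ω : Region) (s : ℂ → Matrix (Fin p) (Fin q) ℂ) :
    ℂ → ℂ → Matrix (Fin p) (Fin p) ℂ :=
  fun ω l => (Ω.rho ω l)⁻¹ • (1 - s l * (s ω)ᴴ)

/-- The generalized Schur class `S_κ^{p×q}(Ω₊)`. -/
structure IsGenSchur {p q : ℕ} (Ω : Region) (κ : ℕ) (s : ℂ → Matrix (Fin p) (Fin q) ℂ) :
    Prop where
  meromorphic : MatMeromorphicOn s Ω.carrier
  negSquares : HasNegSquares (schurKernel Ω (matNF Ω.carrier s)) (holDomain Ω.carrier s) κ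

/-- The kernel `(J - W(l) J W(ω)^*) / ρ_ω(l)`. -/
def innerKernel {m : Type*} [Fintype m] (Ω : Region) (J : Matrix m m ℂ)
    (W : ℂ → Matrix m m ℂ) : ℂ → ℂ → Matrix m m ℂ :=
  fun ω l => (Ω.rho ω l)⁻¹ • (J - W l * J * (W ω)ᴴ)

/-- The class `U_κ(J)` of generalized `J`-inner functions (for a signature matrix `J`). -/
structure IsGenInner {m : Type*} [Fintype m] (Ω : Region) (κ : ℕ) (J : Matrix m m ℂ)
    (W : ℂ → Matrix m m ℂ) : Prop where
  meromorphic : MatMeromorphicOn W Ω.carrier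
  negSquares : HasNegSquares (innerKernel Ω J (matNF Ω.carrier W)) (holDomain Ω.carrier W) κ
  boundary : ∀ᵐ t : ℝ, ∃ L : Matrix m m ℂ,
    HasNontangentialLimit Ω W (Ω.bdryPoint t) L ∧ J - L * J * Lᴴ = 0

/-- The kernel `X(l) J X(ω)^* / ρ_ω(l)`. -/
def admKernel {r m : Type*} [Fintype m] (Ω : Region) (J : Matrix m m ℂ)
    (X : ℂ → Matrix r m ℂ) : ℂ → ℂ → Matrix r r ℂ :=
  fun ω l => (Ω.rho ω l)⁻¹ • (X l * J * (X ω)ᴴ)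

/-- `X` is `(Ω₊, J)_κ`-admissible. -/
structure IsAdmissible {r m : Type*} [Fintype r] [Fintype m] (Ω : Region) (J : Matrix m m ℂ)
    (κ : ℕ) (X : ℂ → Matrix r m ℂ) : Prop where
  meromorphic : MatMeromorphicOn X Ω.carrier
  negSquares : HasNegSquares (admKernel Ω J (matNF Ω.carrier X)) (holDomain Ω.carrier X) κ

/-- The signature matrix `j_{pq}`. -/
def jpq (p q : ℕ) : Matrix (Fin p ⊕ Fin q) (Fin p ⊕ Fin q) ℂ :=
  Matrix.fromBlocks 1 0 0 (-1)

/-! Linear fractional transformations. -/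

/-- The denominator `w₂₁ ε + w₂₂`. -/
def lftDenom {p q : ℕ} (W : ℂ → Matrix (Fin p ⊕ Fin q) (Fin p ⊕ Fin q) ℂ)
    (ε : ℂ → Matrix (Fin p) (Fin q) ℂ) : ℂ → Matrix (Fin q) (Fin q) ℂ :=
  fun z => (W z).toBlocks₂₁ * ε z + (W z).toBlocks₂₂

/-- `T_W[ε] = (w₁₁ ε + w₁₂) (w₂₁ ε + w₂₂)⁻¹`. -/
def lft {p q : ℕ} (W : ℂ → Matrix (Fin p ⊕ Fin q) (Fin p ⊕ Fin q) ℂ)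
    (ε : ℂ → Matrix (Fin p) (Fin q) ℂ) : ℂ → Matrix (Fin p) (Fin q) ℂ :=
  fun z => ((W z).toBlocks₁₁ * ε z + (W z).toBlocks₁₂) * (lftDenom W ε z)⁻¹

/-- The set `T_W[S_κ^{p×q}]`: the functions `s` such that for some `ε` in `S_κ^{p×q}` the
transform `T_W[ε]` is defined off a discrete subset of `Ω₊` and `s = T_W[ε]` as meromorphic
functions on `Ω₊`. -/
def lftImage {p q : ℕ} (Ω : Region) (W : ℂ → Matrix (Fin p ⊕ Fin q) (Fin p ⊕ Fin q) ℂ)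
    (κ : ℕ) : Set (ℂ → Matrix (Fin p) (Fin q) ℂ) :=
  {s | ∃ ε : ℂ → Matrix (Fin p) (Fin q) ℂ, IsGenSchur Ω κ ε ∧
    ∀ᶠ z in codiscreteWithin Ω.carrier, IsUnit (lftDenom W ε z).det ∧ s z = lft W ε z}

end GenSchur

end

open GenSchur

/-!
Write `X = [I, -s] W = [X₁, X₂]`. Where `W` is invertible, `s = T_W[ε]` says exactly that
`X = X₁ [I, -ε]` with `X₁` invertible: both express `[I, -s] W [ε; I] = 0`, and the block
triangular form of `[I, -s; 0, I] W [I, ε; 0, I]` gives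
`det W = det X₁ * det (w₂₁ ε + w₂₂)`. The kernels of `X` and `[I, -ε]` are then congruent
off a discrete set, and negative squares are insensitive to the removal of such a set, because
the number of negative eigenvalues is lower semicontinuous.

It remains to see that `X₁` is generically invertible when `X` is admissible. If `u^* X₁(z) = 0`
with `u ≠ 0`, then `u^* X(z) = [0, y^*]` with `y ≠ 0`, and along `N` such points the Gram
matrix of the kernel is minus the Schur product of the positive definite matrix `1 / ρ` with
a Gram matrix without zeros on the diagonal. It is therefore negative definite, so `N ≤ κ`.
-/

namespace GenSchur

open scoped ComplexOrder

section PosDef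

open scoped Matrix.Norms.L2Operator MatrixOrder

variable {n : Type*} [Finite n] {A : Matrix n n ℂ}

theorem exists_posSemidef_sub_smul_one [DecidableEq n] (hA : A.PosDef) :
    ∃ r : ℝ, 0 < r ∧ (A - r • (1 : Matrix n n ℂ)).PosSemidef := by
  have := Fintype.ofFinite n
  cases isEmpty_or_nonempty n
  · exact ⟨1, one_pos, by rw [Subsingleton.elim (A - _) 0]; exact Matrix.PosSemidef.zero⟩
  obtain ⟨r, hr, hrA⟩ := (CFC.exists_pos_algebraMap_le_iff hA.isHermitian).2 fun x hx =>
    (Matrix.isStrictlyPositive_iff_posDef.2 hA).spectrum_pos hx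
  exact ⟨r, hr, by simpa only [Algebra.algebraMap_eq_smul_one] using Matrix.le_iff.1 hrA⟩

theorem eventually_posDef (hA : A.PosDef) : ∀ᶠ A' in 𝓝 A, A'.IsHermitian → A'.PosDef := by
  classical
  have := Fintype.ofFinite n
  obtain ⟨r, hr, hrA⟩ := exists_posSemidef_sub_smul_one hA
  filter_upwards [Metric.ball_mem_nhds A hr] with A' hA' hherm
  rw [mem_ball_iff_norm] at hA'
  have hdiff : (A' - A + ‖A' - A‖ • (1 : Matrix n n ℂ)).PosSemidef := by
    have := IsSelfAdjoint.neg_algebraMap_norm_le_self (hherm.sub hA.isHermitian)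
    simpa only [Algebra.algebraMap_eq_smul_one, sub_neg_eq_add] using Matrix.le_iff.1 this
  have hsplit : A' = (r - ‖A' - A‖) • (1 : Matrix n n ℂ) +
      ((A - r • (1 : Matrix n n ℂ)) + (A' - A + ‖A' - A‖ • (1 : Matrix n n ℂ))) := by module
  rw [hsplit]
  exact (Matrix.PosDef.one.smul (sub_pos.2 hA')).add_posSemidef (hrA.add hdiff)

theorem posDef_hadamard {B : Matrix n n ℂ} (hA : A.PosDef) (hB : B.PosSemidef)
    (hdiag : ∀ i, B i i ≠ 0) : (A ⊙ B).PosDef := by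
  classical
  obtain ⟨r, hr, hrA⟩ := exists_posSemidef_sub_smul_one hA
  have hD : (Matrix.diagonal fun i => B i i).PosDef :=
    .diagonal fun i => hB.diag_nonneg.lt_of_ne' (hdiag i)
  have hsplit : A ⊙ B =
      r • (Matrix.diagonal fun i => B i i) + (A - r • (1 : Matrix n n ℂ)) ⊙ B := by
    ext i j
    rcases eq_or_ne i j with rfl | hij
    · simp [sub_mul]
    · simp [hij]
  rw [hsplit]
  exact (hD.smul hr).add_posSemidef (hrA.hadamard hB)

end PosDef

section NegCount

variable {n : ℕ} {A : Matrix (Fin n) (Fin n) ℂ}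

theorem exists_posDef_neg_conj (hA : A.IsHermitian) :
    ∃ B : Matrix (Fin n) {i // hA.eigenvalues i < 0} ℂ, (-(Bᴴ * A * B)).PosDef := by
  let U : Matrix (Fin n) (Fin n) ℂ := hA.eigenvectorUnitary
  have hdiag : Uᴴ * A * U = Matrix.diagonal fun i => (hA.eigenvalues i : ℂ) := by
    have := hA.conjStarAlgAut_star_eigenvectorUnitary
    rwa [Unitary.conjStarAlgAut_star_apply] at this
  let B : Matrix (Fin n) {i // hA.eigenvalues i < 0} ℂ := U.submatrix id Subtype.val
  have hsub : Bᴴ * A * B = (Uᴴ * A * U).submatrix Subtype.val Subtype.val := rfl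
  refine ⟨B, ?_⟩
  rw [hsub, hdiag, Matrix.submatrix_diagonal _ _ Subtype.val_injective, Matrix.diagonal_neg]
  exact .diagonal fun i => neg_pos.2 (Complex.real_lt_real.2 i.2)

theorem exists_posSemidef_add_rank_le_negCount (hA : A.IsHermitian) :
    ∃ N : Matrix (Fin n) (Fin n) ℂ, (A + N).PosSemidef ∧ N.rank ≤ negCount hA := by
  let U : Matrix (Fin n) (Fin n) ℂ := hA.eigenvectorUnitary
  let d : Fin n → ℂ := fun i => ((hA.eigenvalues i)⁻ : ℝ)
  refine ⟨U * Matrix.diagonal d * Uᴴ, ?_, ?_⟩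
  · have hspec : A = U * Matrix.diagonal (fun i => (hA.eigenvalues i : ℂ)) * Uᴴ := by
      have := hA.spectral_theorem
      rwa [Unitary.conjStarAlgAut_apply] at this
    have hadd : A + U * Matrix.diagonal d * Uᴴ =
        U * Matrix.diagonal (fun i => (((hA.eigenvalues i)⁺ : ℝ) : ℂ)) * Uᴴ := by
      nth_rw 1 [hspec]
      rw [← Matrix.add_mul, ← Matrix.mul_add, Matrix.diagonal_add]
      congr! 4 with i
      rw [← Complex.ofReal_add, ← eq_add_of_sub_eq (posPart_sub_negPart (hA.eigenvalues i))]
    rw [hadd]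
    refine (Matrix.PosSemidef.diagonal fun i => ?_).mul_mul_conjTranspose_same U
    exact Complex.zero_le_real.2 (posPart_nonneg _)
  · calc (U * Matrix.diagonal d * Uᴴ).rank ≤ (Matrix.diagonal d).rank :=
          (Matrix.rank_mul_le_left _ _).trans (Matrix.rank_mul_le_right _ _)
      _ = negCount hA := by
        rw [Matrix.rank_diagonal, Fintype.card_subtype, negCount]
        simp [d]

theorem card_le_negCount (hA : A.IsHermitian) {ι : Type*} [Fintype ι] (B : Matrix (Fin n) ι ℂ)
    (hB : (-(Bᴴ * A * B)).PosDef) : Fintype.card ι ≤ negCount hA := by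
  classical
  obtain ⟨N, hN, hrank⟩ := exists_posSemidef_add_rank_le_negCount hA
  have hpos : (Bᴴ * N * B).PosDef := by
    have := hB.add_posSemidef (hN.conjTranspose_mul_mul_same B)
    rwa [Matrix.mul_add, Matrix.add_mul, neg_add_cancel_left] at this
  calc Fintype.card ι = (Bᴴ * N * B).rank := (Matrix.rank_of_isUnit _ hpos.isUnit).symm
    _ ≤ N.rank := (Matrix.rank_mul_le_left _ _).trans (Matrix.rank_mul_le_right _ _)
    _ ≤ negCount hA := hrank

theorem eventually_negCount_le (hA : A.IsHermitian) :
    ∀ᶠ A' in 𝓝 A, ∀ hA' : A'.IsHermitian, negCount hA ≤ negCount hA' := by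
  obtain ⟨B, hB⟩ := exists_posDef_neg_conj hA
  have hcont : Continuous fun A' : Matrix (Fin n) (Fin n) ℂ => -(Bᴴ * A' * B) := by fun_prop
  filter_upwards [(hcont.tendsto A).eventually (eventually_posDef hB)] with A' h hA'
  have := card_le_negCount hA' B (h (Matrix.isHermitian_conjTranspose_mul_mul B hA').neg)
  rwa [Fintype.card_subtype] at this

end NegCount

section Kernel

variable {m r : Type*} [Fintype m] [Fintype r] {K : ℂ → ℂ → Matrix m m ℂ} {D D₀ : Set ℂ} {κ : ℕ}

theorem continuousOn_kernelGram (hcont : ContinuousOn (Function.uncurry K) (D ×ˢ D)) {n : ℕ}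
    (u : Fin n → m → ℂ) :
    ContinuousOn (fun ω => kernelGram K ω u) (Set.univ.pi fun _ => D) := by
  refine continuousOn_pi.2 fun j => continuousOn_pi.2 fun k => ?_
  have hK : ContinuousOn (fun ω : Fin n → ℂ => K (ω j) (ω k)) (Set.univ.pi fun _ => D) :=
    hcont.comp (f := fun ω : Fin n → ℂ => (ω j, ω k)) (by fun_prop)
      fun ω hω => ⟨hω j trivial, hω k trivial⟩
  rw [continuousOn_iff_continuous_domRestrict] at hK ⊢
  exact continuous_const.dotProduct (hK.matrix_mulVec continuous_const)

theorem exists_negCount_le_of_dense (hK : IsHermitianKernel K D) (hsub : D₀ ⊆ D)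
    (hdense : D ⊆ closure D₀) (hcont : ContinuousOn (Function.uncurry K) (D ×ˢ D))
    {n : ℕ} (ω : Fin n → ℂ) (u : Fin n → m → ℂ) (hω : ∀ j, ω j ∈ D) :
    ∃ (ω' : Fin n → ℂ) (hω' : ∀ j, ω' j ∈ D₀),
      negCount (hK.gram hω u) ≤ negCount (hK.gram (fun j => hsub (hω' j)) u) := by
  have hcl : ω ∈ closure (Set.univ.pi fun _ => D₀) := by
    rw [closure_pi_set]
    exact fun j _ => hdense (hω j)
  have := mem_closure_iff_nhdsWithin_neBot.1 hcl
  have hlim : Tendsto (fun ω' => kernelGram K ω' u) (𝓝[Set.univ.pi fun _ => D₀] ω)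
      (𝓝 (kernelGram K ω u)) :=
    (continuousOn_kernelGram hcont u ω fun j _ => hω j).mono_left
      (nhdsWithin_mono _ (Set.pi_mono fun _ _ => hsub))
  obtain ⟨ω', hle, hmem⟩ :=
    ((hlim.eventually (eventually_negCount_le (hK.gram hω u))).and self_mem_nhdsWithin).exists
  exact ⟨ω', fun j => hmem j trivial, hle _⟩

theorem IsHermitianKernel.hasNegSquares_iff_of_dense (hK : IsHermitianKernel K D) (hsub : D₀ ⊆ D)
    (hdense : D ⊆ closure D₀) (hcont : ContinuousOn (Function.uncurry K) (D ×ˢ D)) :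
    HasNegSquares K D κ ↔ HasNegSquares K D₀ κ := by
  constructor <;> intro h
  · have hle : ∀ (n : ℕ) (ω : Fin n → ℂ) (u : Fin n → m → ℂ) (hω : ∀ j, ω j ∈ D₀),
        negCount (hK.gram (fun j => hsub (hω j)) u) ≤ κ :=
      fun n ω u hω => h.le n ω u fun j => hsub (hω j)
    obtain ⟨n, ω, u, hω, hn⟩ := h.attained
    obtain ⟨ω', hω', hn'⟩ := exists_negCount_le_of_dense hK hsub hdense hcont ω u hω
    exact ⟨fun ω hω l hl => hK ω (hsub hω) l (hsub hl), hle,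
      n, ω', u, hω', (hle n ω' u hω').antisymm (hn.symm.le.trans hn')⟩
  · refine ⟨hK, fun n ω u hω => ?_, ?_⟩
    · obtain ⟨ω', hω', hn⟩ := exists_negCount_le_of_dense hK hsub hdense hcont ω u hω
      exact hn.trans (h.le n ω' u hω')
    · obtain ⟨n, ω, u, hω, hn⟩ := h.attained
      exact ⟨n, ω, u, fun j => hsub (hω j), hn⟩

theorem kernelGram_eq_of_congruence {K' : ℂ → ℂ → Matrix r r ℂ} {a : ℂ → Matrix r m ℂ}
    (hK' : ∀ ω ∈ D, ∀ l ∈ D, K' ω l = a l * K ω l * (a ω)ᴴ) {n : ℕ} {ω : Fin n → ℂ}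
    (hω : ∀ j, ω j ∈ D) (u : Fin n → r → ℂ) :
    kernelGram K' ω u = kernelGram K ω fun j => (a (ω j))ᴴ *ᵥ u j := by
  ext j k
  simp only [kernelGram, Matrix.of_apply]
  rw [hK' _ (hω j) _ (hω k), Matrix.star_mulVec, Matrix.conjTranspose_conjTranspose,
    ← Matrix.dotProduct_mulVec, Matrix.mulVec_mulVec, Matrix.mulVec_mulVec, Matrix.mul_assoc]

theorem HasNegSquares.of_congruence [DecidableEq m] {K' : ℂ → ℂ → Matrix r r ℂ}
    (h : HasNegSquares K D κ) {a : ℂ → Matrix r m ℂ} {b : ℂ → Matrix m r ℂ}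
    (hba : ∀ z ∈ D, b z * a z = 1)
    (hK' : ∀ ω ∈ D, ∀ l ∈ D, K' ω l = a l * K ω l * (a ω)ᴴ) : HasNegSquares K' D κ := by
  have hherm : IsHermitianKernel K' D := fun ω hω l hl => by
    simp [hK' ω hω l hl, hK' l hl ω hω, ← h.hermitian ω hω l hl, Matrix.mul_assoc]
  refine ⟨hherm, fun n ω u hω => ?_, ?_⟩
  · simpa only [kernelGram_eq_of_congruence hK' hω u] using h.le n ω _ hω
  · obtain ⟨n, ω, u, hω, hn⟩ := h.attained
    have hu : u = fun j => (a (ω j))ᴴ *ᵥ (b (ω j))ᴴ *ᵥ u j := by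
      funext j
      rw [Matrix.mulVec_mulVec, ← Matrix.conjTranspose_mul, hba _ (hω j),
        Matrix.conjTranspose_one, Matrix.one_mulVec]
    refine ⟨n, ω, fun j => (b (ω j))ᴴ *ᵥ u j, hω, ?_⟩
    simpa only [kernelGram_eq_of_congruence hK' hω, ← hu] using hn

end Kernel

theorem posDef_szego {N : ℕ} {z : Fin N → ℂ} (hz : ∀ j, ‖z j‖ < 1) (hinj : Function.Injective z) :
    (Matrix.of fun j k => (1 - star (z j) * z k)⁻¹).PosDef := by
  have hherm : (Matrix.of fun j k => (1 - star (z j) * z k)⁻¹).IsHermitian := by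
    ext j k
    simp [mul_comm]
  refine .of_dotProduct_mulVec_pos hherm fun c hc => ?_
  have hsum : HasSum (fun n : ℕ => ∑ j, ∑ k, star (c j) * ((star (z j) * z k) ^ n * c k))
      (star c ⬝ᵥ (Matrix.of fun j k => (1 - star (z j) * z k)⁻¹) *ᵥ c) := by
    simp only [dotProduct, Matrix.mulVec, Matrix.of_apply, Finset.mul_sum, Pi.star_apply]
    refine hasSum_sum fun j _ => hasSum_sum fun k _ => HasSum.mul_left _ (HasSum.mul_right _ ?_)
    refine hasSum_geometric_of_norm_lt_one ?_
    rw [norm_mul, norm_star]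
    exact mul_lt_one_of_nonneg_of_lt_one_left (norm_nonneg _) (hz j) (hz k).le
  have hterm : ∀ n : ℕ, ∑ j, ∑ k, star (c j) * ((star (z j) * z k) ^ n * c k) =
      star (∑ k, c k * z k ^ n) * ∑ k, c k * z k ^ n := by
    intro n
    rw [star_sum, Finset.sum_mul_sum]
    refine Finset.sum_congr rfl fun j _ => Finset.sum_congr rfl fun k _ => ?_
    rw [star_mul', star_pow, mul_pow]
    ring
  simp only [hterm] at hsum
  have hnonneg : ∀ n : ℕ, 0 ≤ star (∑ k, c k * z k ^ n) * ∑ k, c k * z k ^ n :=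
    fun n => star_mul_self_nonneg _
  refine (hsum.nonneg hnonneg).lt_of_ne' fun h0 => hc ?_
  rw [h0, hasSum_zero_iff_of_nonneg hnonneg] at hsum
  exact Matrix.eq_zero_of_forall_pow_sum_mul_pow_eq_zero hinj fun i =>
    (CStarRing.star_mul_self_eq_zero_iff _).1 (congrFun hsum i)

namespace Region

variable {Ω : Region} {ω l : ℂ}

theorem rho_ne_zero (hω : ω ∈ Ω.carrier) (hl : l ∈ Ω.carrier) : Ω.rho ω l ≠ 0 := by
  cases Ω with
  | disk =>
    refine sub_ne_zero.2 fun h => ?_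
    have hlt : ‖l * (starRingEnd ℂ) ω‖ < 1 := by
      rw [norm_mul, RCLike.norm_conj]
      exact mul_lt_one_of_nonneg_of_lt_one_left (norm_nonneg _) hl (le_of_lt hω)
    rw [← h, norm_one] at hlt
    exact lt_irrefl _ hlt
  | halfPlane =>
    have hre : 0 < (l + (starRingEnd ℂ) ω).re := by simpa using add_pos hl hω
    have hπ : (2 * (Real.pi : ℂ)) ≠ 0 := by simp [Real.pi_ne_zero]
    exact mul_ne_zero hπ fun h => hre.ne' (by rw [h, Complex.zero_re])

theorem star_rho (Ω : Region) (ω l : ℂ) : star (Ω.rho ω l) = Ω.rho l ω := by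
  cases Ω <;> simp [rho, mul_comm, add_comm]

theorem continuous_rho (Ω : Region) : Continuous (Function.uncurry Ω.rho) := by
  cases Ω
  · change Continuous fun z : ℂ × ℂ => 1 - z.2 * (starRingEnd ℂ) z.1
    fun_prop
  · change Continuous fun z : ℂ × ℂ => 2 * (Real.pi : ℂ) * (z.2 + (starRingEnd ℂ) z.1)
    fun_prop

theorem isOpen_carrier (Ω : Region) : IsOpen Ω.carrier := by
  cases Ω
  · exact isOpen_lt continuous_norm continuous_const
  · exact isOpen_lt continuous_const Complex.continuous_re

theorem isPreconnected_carrier (Ω : Region) : IsPreconnected Ω.carrier := by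
  cases Ω with
  | disk =>
    have hball : disk.carrier = Metric.ball 0 1 := by ext; simp [carrier]
    exact hball ▸ (convex_ball 0 1).isPreconnected
  | halfPlane => exact (convex_halfSpace_re_gt 0).isPreconnected

theorem add_one_ne_zero_of_mem_halfPlane {z : ℂ} (hz : z ∈ halfPlane.carrier) : z + 1 ≠ 0 := by
  have hre : 0 < (z + 1).re := by simpa using add_pos hz one_pos
  exact fun h => hre.ne' (by rw [h, Complex.zero_re])

theorem injOn_cayley : Set.InjOn (fun z : ℂ => (z - 1) / (z + 1)) halfPlane.carrier := by
  intro z hz w hw h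
  have := (div_eq_div_iff (add_one_ne_zero_of_mem_halfPlane hz)
    (add_one_ne_zero_of_mem_halfPlane hw)).1 h
  linear_combination this / 2

theorem norm_cayley_lt_one {z : ℂ} (hz : z ∈ halfPlane.carrier) : ‖(z - 1) / (z + 1)‖ < 1 := by
  have hre : 0 < z.re := hz
  rw [norm_div, div_lt_one (norm_pos_iff.2 (add_one_ne_zero_of_mem_halfPlane hz)),
    ← sq_lt_sq₀ (norm_nonneg _) (norm_nonneg _), ← Complex.normSq_eq_norm_sq,
    ← Complex.normSq_eq_norm_sq, Complex.normSq_apply, Complex.normSq_apply]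
  simp only [Complex.sub_re, Complex.one_re, Complex.sub_im, Complex.one_im, Complex.add_re,
    Complex.add_im]
  linarith

theorem rho_halfPlane_inv (hω : ω ∈ halfPlane.carrier) (hl : l ∈ halfPlane.carrier) :
    (halfPlane.rho ω l)⁻¹ = star ((√Real.pi * (ω + 1))⁻¹ : ℂ) *
      (1 - star ((ω - 1) / (ω + 1)) * ((l - 1) / (l + 1)))⁻¹ * (√Real.pi * (l + 1))⁻¹ := by
  have hω₁ : (starRingEnd ℂ) ω + 1 ≠ 0 := by
    simpa using (map_ne_zero (starRingEnd ℂ)).2 (add_one_ne_zero_of_mem_halfPlane hω)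
  have hl₁ := add_one_ne_zero_of_mem_halfPlane hl
  have hadd : l + (starRingEnd ℂ) ω ≠ 0 := (mul_ne_zero_iff.1 (rho_ne_zero hω hl)).2
  have hπ : (√Real.pi : ℂ) * √Real.pi = Real.pi := by
    rw [← Complex.ofReal_mul, Real.mul_self_sqrt Real.pi_pos.le]
  have hπ₀ : (√Real.pi : ℂ) ≠ 0 := by simp [Real.sqrt_ne_zero', Real.pi_pos]
  have hcayley : 1 - ((starRingEnd ℂ) ω - 1) / ((starRingEnd ℂ) ω + 1) * ((l - 1) / (l + 1)) =
      2 * (l + (starRingEnd ℂ) ω) / ((l + 1) * ((starRingEnd ℂ) ω + 1)) := by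
    field_simp
    ring
  simp only [rho, RCLike.star_def, map_inv₀, map_mul, map_add, map_one, map_div₀, map_sub,
    Complex.conj_ofReal, hcayley, ← hπ]
  field_simp

theorem posDef_rho_inv {N : ℕ} {ω : Fin N → ℂ} (hω : ∀ j, ω j ∈ Ω.carrier)
    (hinj : Function.Injective ω) : (Matrix.of fun j k => (Ω.rho (ω j) (ω k))⁻¹).PosDef := by
  cases Ω with
  | disk => simpa [rho, mul_comm] using posDef_szego hω hinj
  | halfPlane =>
    let g : Fin N → ℂ := fun j => (√Real.pi * (ω j + 1))⁻¹
    have hg : IsUnit (Matrix.diagonal g) := by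
      rw [Matrix.isUnit_diagonal, Pi.isUnit_iff]
      intro j
      simp [g, Real.sqrt_ne_zero', Real.pi_pos, add_one_ne_zero_of_mem_halfPlane (hω j)]
    have hS := posDef_szego (fun j => norm_cayley_lt_one (hω j))
      (fun j k h => hinj (injOn_cayley (hω j) (hω k) h))
    convert! hS.conjTranspose_mul_mul_same (B := Matrix.diagonal g)
      (Matrix.mulVec_injective_of_isUnit hg) using 1
    ext j k
    simp [rho_halfPlane_inv (hω j) (hω k), Matrix.diagonal_conjTranspose, g]

end Region

namespace Region

theorem continuous_bdryDist (Ω : Region) : Continuous Ω.bdryDist := by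
  cases Ω
  · exact continuous_const.sub continuous_norm
  · exact Complex.continuous_re

theorem isOpen_stolz (Ω : Region) (M : ℝ) (μ : ℂ) : IsOpen (Ω.stolz M μ) :=
  Ω.isOpen_carrier.inter (isOpen_lt (by fun_prop) (continuous_const.mul Ω.continuous_bdryDist))

theorem smul_bdryPoint_mem_stolz_disk {M r : ℝ} (hM : 1 < M) (hr : r ∈ Set.Ioo 0 1) (t : ℝ) :
    (1 - r) • disk.bdryPoint t ∈ disk.stolz M (disk.bdryPoint t) := by
  have hμ : ‖disk.bdryPoint t‖ = 1 := Complex.norm_exp_ofReal_mul_I t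
  have hnorm : ‖(1 - r) • disk.bdryPoint t‖ = 1 - r := by
    rw [norm_smul, hμ, mul_one, Real.norm_of_nonneg (sub_nonneg.2 hr.2.le)]
  have hdist : ‖(1 - r) • disk.bdryPoint t - disk.bdryPoint t‖ = r := by
    rw [sub_smul, one_smul, sub_sub_cancel_left, norm_neg, norm_smul, hμ, mul_one,
      Real.norm_of_nonneg hr.1.le]
  refine ⟨hnorm.trans_lt (sub_lt_self 1 hr.1), ?_⟩
  rw [hdist, bdryDist, hnorm, sub_sub_cancel]
  exact lt_mul_of_one_lt_left hr.1 hM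

theorem bdryPoint_add_mem_stolz_halfPlane {M r : ℝ} (hM : 1 < M) (hr : 0 < r) (t : ℝ) :
    halfPlane.bdryPoint t + r ∈ halfPlane.stolz M (halfPlane.bdryPoint t) := by
  have hre : (halfPlane.bdryPoint t + r).re = r := by simp [bdryPoint]
  refine ⟨hr.trans_eq hre.symm, ?_⟩
  rw [add_sub_cancel_left, bdryDist, hre, Complex.norm_real, Real.norm_of_nonneg hr.le]
  exact lt_mul_of_one_lt_left hr hM

theorem mem_closure_stolz (Ω : Region) {M : ℝ} (hM : 1 < M) (t : ℝ) :
    Ω.bdryPoint t ∈ closure (Ω.stolz M (Ω.bdryPoint t)) := by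
  cases Ω with
  | disk =>
    have hlim : Tendsto (fun r : ℝ => (1 - r) • disk.bdryPoint t) (𝓝[>] 0)
        (𝓝 (disk.bdryPoint t)) := by
      have : Continuous fun r : ℝ => (1 - r) • disk.bdryPoint t := by fun_prop
      simpa using (this.tendsto 0).mono_left nhdsWithin_le_nhds
    refine mem_closure_of_tendsto hlim ?_
    filter_upwards [Ioo_mem_nhdsGT (zero_lt_one' ℝ)] with r hr
    exact smul_bdryPoint_mem_stolz_disk hM hr t
  | halfPlane =>
    have hlim : Tendsto (fun r : ℝ => halfPlane.bdryPoint t + r) (𝓝[>] 0)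
        (𝓝 (halfPlane.bdryPoint t)) := by
      have : Continuous fun r : ℝ => halfPlane.bdryPoint t + r := by fun_prop
      simpa using (this.tendsto 0).mono_left nhdsWithin_le_nhds
    refine mem_closure_of_tendsto hlim ?_
    filter_upwards [self_mem_nhdsWithin] with r hr
    exact bdryPoint_add_mem_stolz_halfPlane hM hr t

end Region

theorem subset_closure_of_codiscreteWithin {U S : Set ℂ} (hU : IsOpen U)
    (hS : S ∈ codiscreteWithin U) : U ⊆ closure S := by
  intro x hx
  have hS' : S ∈ 𝓝[≠] x := by
    filter_upwards [mem_codiscreteWithin_iff_forall_mem_nhdsNE.1 hS x hx,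
      mem_nhdsWithin_of_mem_nhds (hU.mem_nhds hx)] with z hz hzU
    exact hz.resolve_right fun h => h hzU
  exact mem_closure_iff_frequently.2
    ((eventually_mem_set.2 hS').frequently.filter_mono nhdsWithin_le_nhds)

theorem eventually_ne_zero_or_eventually_eq_zero {U : Set ℂ} (hU : IsPreconnected U) {g : ℂ → ℂ}
    (hg : MeromorphicOn g U) :
    (∀ᶠ z in codiscreteWithin U, g z ≠ 0) ∨ ∀ᶠ z in codiscreteWithin U, g z = 0 := by
  refine or_iff_not_imp_left.2 fun h => ?_
  obtain ⟨u, hu, htop⟩ : ∃ u ∈ U, meromorphicOrderAt g u = ⊤ := by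
    by_contra! hord
    exact h (MeromorphicAt.MeromorphicOn.codiscreteWithin_setOfPred_ne_zero hg hord)
  refine mem_codiscreteWithin_iff_forall_mem_nhdsNE.2 fun x hx => ?_
  have hxtop : meromorphicOrderAt g x = ⊤ := by
    by_contra hne
    exact hg.meromorphicOrderAt_ne_top_of_isPreconnected hU hx hu hne htop
  filter_upwards [meromorphicOrderAt_eq_top_iff.1 hxtop] with z hz using Or.inl hz

namespace MatMeromorphicOn

variable {l m n : Type*} {U : Set ℂ}

theorem const (A : Matrix m n ℂ) : MatMeromorphicOn (fun _ => A) U :=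
  fun i j => MeromorphicOn.const (A i j)

theorem neg {f : ℂ → Matrix m n ℂ} (hf : MatMeromorphicOn f U) :
    MatMeromorphicOn (fun z => -f z) U :=
  fun i j => (hf i j).fun_neg

theorem mul [Fintype m] {f : ℂ → Matrix l m ℂ} {g : ℂ → Matrix m n ℂ}
    (hf : MatMeromorphicOn f U) (hg : MatMeromorphicOn g U) :
    MatMeromorphicOn (fun z => f z * g z) U := by
  intro i j
  simp only [Matrix.mul_apply]
  exact MeromorphicOn.fun_sum fun k => (hf i k).fun_mul (hg k j)

theorem det [Fintype m] [DecidableEq m] {f : ℂ → Matrix m m ℂ} (hf : MatMeromorphicOn f U) :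
    MeromorphicOn (fun z => (f z).det) U := by
  simp only [Matrix.det_apply']
  exact MeromorphicOn.fun_sum fun σ => (MeromorphicOn.const _).fun_mul
    (MeromorphicOn.fun_prod fun i _ => hf _ _)

theorem inv [Fintype m] [DecidableEq m] {f : ℂ → Matrix m m ℂ} (hf : MatMeromorphicOn f U) :
    MatMeromorphicOn (fun z => (f z)⁻¹) U := by
  intro i j
  simp only [Matrix.inv_def, Matrix.smul_apply, Ring.inverse_eq_inv', smul_eq_mul,
    Matrix.adjugate_apply]
  refine hf.det.fun_inv.fun_mul (MatMeromorphicOn.det fun a b => ?_)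
  rcases eq_or_ne a j with rfl | h
  · simpa using MeromorphicOn.const _
  · simpa [Matrix.updateRow_ne h] using hf a b

theorem fromCols {f : ℂ → Matrix l m ℂ} {g : ℂ → Matrix l n ℂ}
    (hf : MatMeromorphicOn f U) (hg : MatMeromorphicOn g U) :
    MatMeromorphicOn (fun z => Matrix.fromCols (f z) (g z)) U := by
  rintro i (j | j)
  · exact hf i j
  · exact hg i j

theorem toCols₁ {f : ℂ → Matrix l (m ⊕ n) ℂ} (hf : MatMeromorphicOn f U) :
    MatMeromorphicOn (fun z => (f z).toCols₁) U :=
  fun i j => hf i (Sum.inl j)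

theorem toCols₂ {f : ℂ → Matrix l (m ⊕ n) ℂ} (hf : MatMeromorphicOn f U) :
    MatMeromorphicOn (fun z => (f z).toCols₂) U :=
  fun i j => hf i (Sum.inr j)

theorem eventually_matNF_eq [Finite m] [Finite n] {f : ℂ → Matrix m n ℂ}
    (hf : MatMeromorphicOn f U) : ∀ᶠ z in codiscreteWithin U, matNF U f z = f z := by
  have h : ∀ᶠ z in codiscreteWithin U, ∀ i j, f z i j = matNF U f z i j :=
    eventually_all.2 fun i => eventually_all.2 fun j => toMeromorphicNFOn_eqOn_codiscrete (hf i j)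
  filter_upwards [h] with z hz
  ext i j
  exact (hz i j).symm

end MatMeromorphicOn

theorem eventually_mem_holDomain {m n : Type*} [Finite m] [Finite n] {U : Set ℂ}
    (f : ℂ → Matrix m n ℂ) : ∀ᶠ z in codiscreteWithin U, z ∈ holDomain U f := by
  have hmero : MatMeromorphicOn (matNF U f) U :=
    fun i j => (meromorphicNFOn_toMeromorphicNFOn (fun w => f w i j) U).meromorphicOn
  have h : ∀ᶠ z in codiscreteWithin U, ∀ i j, AnalyticAt ℂ (fun w => matNF U f w i j) z :=
    eventually_all.2 fun i => eventually_all.2 fun j => (hmero i j).analyticAt_mem_codiscreteWithin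
  filter_upwards [h, self_mem_codiscreteWithin U] with z hz hzU using ⟨hzU, hz⟩

theorem continuousOn_matNF {m n : Type*} {U : Set ℂ} (f : ℂ → Matrix m n ℂ) :
    ContinuousOn (matNF U f) (holDomain U f) :=
  continuousOn_pi.2 fun i => continuousOn_pi.2 fun j => fun _ hz =>
    (hz.2 i j).continuousAt.continuousWithinAt

theorem eventually_isUnit_det_of_boundary {m : Type*} [Fintype m] [DecidableEq m] {Ω : Region}
    {J : Matrix m m ℂ} (hJ : IsUnit J.det) {W : ℂ → Matrix m m ℂ}
    (hW : MatMeromorphicOn W Ω.carrier)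
    (hb : ∀ᵐ t : ℝ, ∃ L : Matrix m m ℂ,
      HasNontangentialLimit Ω W (Ω.bdryPoint t) L ∧ J - L * J * Lᴴ = 0) :
    ∀ᶠ z in codiscreteWithin Ω.carrier, IsUnit (W z).det := by
  simp only [isUnit_iff_ne_zero]
  refine (eventually_ne_zero_or_eventually_eq_zero
    Ω.isPreconnected_carrier hW.det).resolve_right fun h => ?_
  obtain ⟨t, L, hL, hJL⟩ := hb.exists
  have hLdet : L.det ≠ 0 := fun h0 => hJ.ne_zero <| by
    rw [sub_eq_zero.1 hJL, Matrix.det_mul, Matrix.det_mul, h0, zero_mul, zero_mul]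
  set Z : Set ℂ := {z | (matNF Ω.carrier W z).det = 0}
  have hdense : Ω.carrier ⊆ closure Z := by
    refine subset_closure_of_codiscreteWithin Ω.isOpen_carrier ?_
    filter_upwards [h, hW.eventually_matNF_eq] with z hz hNF
    exact (congrArg Matrix.det hNF).trans hz
  have hcl : Ω.bdryPoint t ∈ closure (Ω.stolz 2 (Ω.bdryPoint t) ∩ Z) := by
    refine closure_minimal (fun z hz => ?_) isClosed_closure (Ω.mem_closure_stolz one_lt_two t)
    exact (Ω.isOpen_stolz _ _).inter_closure ⟨hz, hdense hz.1⟩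
  have := mem_closure_iff_nhdsWithin_neBot.1 hcl
  have hlim : Tendsto (matNF Ω.carrier W) (𝓝[Ω.stolz 2 (Ω.bdryPoint t) ∩ Z] Ω.bdryPoint t)
      (𝓝 L) :=
    tendsto_pi_nhds.2 fun i => tendsto_pi_nhds.2 fun j =>
      (hL 2 one_lt_two i j).mono_left (nhdsWithin_mono _ Set.inter_subset_left)
  have hdet : Tendsto (fun z => (matNF Ω.carrier W z).det)
      (𝓝[Ω.stolz 2 (Ω.bdryPoint t) ∩ Z] Ω.bdryPoint t) (𝓝 0) :=
    tendsto_const_nhds.congr' (by filter_upwards [self_mem_nhdsWithin] with z hz using hz.2.symm)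
  exact hLdet (tendsto_nhds_unique ((continuous_id.matrix_det.tendsto L).comp hlim) hdet)

section Jpq

variable {p q : ℕ} {r : Type*}

theorem jpq_mul_self (p q : ℕ) : jpq p q * jpq p q = 1 := by
  simp [jpq, Matrix.fromBlocks_multiply]

theorem conjTranspose_jpq (p q : ℕ) : (jpq p q)ᴴ = jpq p q := by
  simp [jpq, Matrix.fromBlocks_conjTranspose]

theorem mul_jpq_mul_conjTranspose (A B : Matrix r (Fin p ⊕ Fin q) ℂ) :
    A * jpq p q * Bᴴ = A.toCols₁ * B.toCols₁ᴴ - A.toCols₂ * B.toCols₂ᴴ := by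
  conv_lhs => rw [← Matrix.fromCols_toCols A, ← Matrix.fromCols_toCols B]
  rw [jpq, Matrix.fromCols_mul_fromBlocks, Matrix.conjTranspose_fromCols_eq_fromRows_conjTranspose,
    Matrix.fromCols_mul_fromRows]
  simp [sub_eq_add_neg]

theorem schurKernel_eq_admKernel (Ω : Region) (s : ℂ → Matrix (Fin p) (Fin q) ℂ) :
    schurKernel Ω s = admKernel Ω (jpq p q) fun z => Matrix.fromCols 1 (-(s z)) := by
  funext ω l
  simp [schurKernel, admKernel, mul_jpq_mul_conjTranspose]

end Jpq

section AdmKernel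

variable {r m : Type*} [Fintype m] {Ω : Region} {J : Matrix m m ℂ} {X Y : ℂ → Matrix r m ℂ}
  {D D₀ : Set ℂ} {κ : ℕ}

theorem isHermitianKernel_admKernel (hJ : Jᴴ = J) : IsHermitianKernel (admKernel Ω J X) D :=
  fun ω _ l _ => by
    simp [admKernel, Matrix.conjTranspose_smul, ← Ω.star_rho l ω, hJ, Matrix.mul_assoc]

theorem continuousOn_admKernel (hD : D ⊆ Ω.carrier) (hX : ContinuousOn X D) :
    ContinuousOn (Function.uncurry (admKernel Ω J X)) (D ×ˢ D) := by
  have hrho : ContinuousOn (fun z : ℂ × ℂ => (Ω.rho z.1 z.2)⁻¹) (D ×ˢ D) :=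
    Ω.continuous_rho.continuousOn.inv₀ fun _ hz => Region.rho_ne_zero (hD hz.1) (hD hz.2)
  have hfst : ContinuousOn (fun z : ℂ × ℂ => X z.1) (D ×ˢ D) :=
    hX.comp continuousOn_fst fun _ hz => hz.1
  have hsnd : ContinuousOn (fun z : ℂ × ℂ => X z.2) (D ×ˢ D) :=
    hX.comp continuousOn_snd fun _ hz => hz.2
  rw [continuousOn_iff_continuous_domRestrict] at hrho hfst hsnd ⊢
  exact hrho.smul ((hsnd.matrix_mul continuous_const).matrix_mul hfst.matrix_conjTranspose)

variable [Fintype r]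

theorem hasNegSquares_admKernel_iff_of_dense (hJ : Jᴴ = J) (hD : D ⊆ Ω.carrier)
    (hX : ContinuousOn X D) (hsub : D₀ ⊆ D) (hdense : D ⊆ closure D₀) :
    HasNegSquares (admKernel Ω J X) D κ ↔ HasNegSquares (admKernel Ω J X) D₀ κ :=
  (isHermitianKernel_admKernel hJ).hasNegSquares_iff_of_dense hsub hdense
    (continuousOn_admKernel hD hX)

variable [DecidableEq r] {a : ℂ → Matrix r r ℂ}

theorem HasNegSquares.admKernel_of_eq_mul (h : HasNegSquares (admKernel Ω J Y) D κ)
    (ha : ∀ z ∈ D, IsUnit (a z).det) (hXY : ∀ z ∈ D, X z = a z * Y z) :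
    HasNegSquares (admKernel Ω J X) D κ := by
  refine h.of_congruence (fun z hz => Matrix.nonsing_inv_mul (a z) (ha z hz)) fun ω hω l hl => ?_
  rw [admKernel, admKernel, hXY ω hω, hXY l hl, Matrix.conjTranspose_mul, Matrix.mul_smul,
    Matrix.smul_mul]
  simp only [Matrix.mul_assoc]

theorem hasNegSquares_admKernel_iff_of_eq_mul (ha : ∀ z ∈ D, IsUnit (a z).det)
    (hXY : ∀ z ∈ D, X z = a z * Y z) :
    HasNegSquares (admKernel Ω J X) D κ ↔ HasNegSquares (admKernel Ω J Y) D κ := by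
  refine ⟨fun h => ?_, fun h => h.admKernel_of_eq_mul ha hXY⟩
  refine h.admKernel_of_eq_mul (a := fun z => (a z)⁻¹) (fun z hz => ?_) fun z hz => ?_
  · exact Matrix.isUnit_nonsing_inv_det _ (ha z hz)
  · rw [hXY z hz, Matrix.nonsing_inv_mul_cancel_left _ _ (ha z hz)]

end AdmKernel

theorem continuousOn_fromCols {α l m n : Type*} [TopologicalSpace α] {s : Set α}
    {f : α → Matrix l m ℂ} {g : α → Matrix l n ℂ} (hf : ContinuousOn f s)
    (hg : ContinuousOn g s) : ContinuousOn (fun z => Matrix.fromCols (f z) (g z)) s := by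
  refine continuousOn_pi.2 fun i => continuousOn_pi.2 ?_
  rintro (j | j)
  · exact continuousOn_pi.1 (continuousOn_pi.1 hf i) j
  · exact continuousOn_pi.1 (continuousOn_pi.1 hg i) j

theorem isAdmissible_iff_isGenSchur {p q : ℕ} {Ω : Region} {κ : ℕ}
    {X : ℂ → Matrix (Fin p) (Fin p ⊕ Fin q) ℂ} {a : ℂ → Matrix (Fin p) (Fin p) ℂ}
    {ε : ℂ → Matrix (Fin p) (Fin q) ℂ} (hX : MatMeromorphicOn X Ω.carrier)
    (hε : MatMeromorphicOn ε Ω.carrier)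
    (h : ∀ᶠ z in codiscreteWithin Ω.carrier, IsUnit (a z).det ∧
      X z = a z * Matrix.fromCols (1 : Matrix (Fin p) (Fin p) ℂ) (-(ε z))) :
    IsAdmissible Ω (jpq p q) κ X ↔ IsGenSchur Ω κ ε := by
  let Y : ℂ → Matrix (Fin p) (Fin p ⊕ Fin q) ℂ :=
    fun z => Matrix.fromCols 1 (-(matNF Ω.carrier ε z))
  have hY : ContinuousOn Y (holDomain Ω.carrier ε) :=
    continuousOn_fromCols continuousOn_const (continuousOn_matNF ε).neg
  let D₀ : Set ℂ := {z | z ∈ holDomain Ω.carrier X ∧ z ∈ holDomain Ω.carrier ε ∧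
    IsUnit (a z).det ∧ matNF Ω.carrier X z = a z * Y z}
  have hdense : Ω.carrier ⊆ closure D₀ := by
    refine subset_closure_of_codiscreteWithin Ω.isOpen_carrier ?_
    filter_upwards [eventually_mem_holDomain X,
      eventually_mem_holDomain ε, hX.eventually_matNF_eq, hε.eventually_matNF_eq, h]
      with z hzX hzε hNFX hNFε hz
    exact ⟨hzX, hzε, hz.1, by simp only [Y, hNFX, hNFε, hz.2]⟩
  have key : HasNegSquares (admKernel Ω (jpq p q) (matNF Ω.carrier X)) (holDomain Ω.carrier X) κ ↔
      HasNegSquares (schurKernel Ω (matNF Ω.carrier ε)) (holDomain Ω.carrier ε) κ := by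
    have hJ := conjTranspose_jpq p q
    rw [schurKernel_eq_admKernel,
      hasNegSquares_admKernel_iff_of_dense hJ (fun z hz => hz.1) (continuousOn_matNF X)
        (D₀ := D₀) (fun z hz => hz.1) (fun z hz => hdense hz.1),
      hasNegSquares_admKernel_iff_of_dense hJ (fun z hz => hz.1) hY
        (D₀ := D₀) (fun z hz => hz.2.1) (fun z hz => hdense hz.1),
      hasNegSquares_admKernel_iff_of_eq_mul (fun z hz => hz.2.2.1) (fun z hz => hz.2.2.2)]
  exact ⟨fun hA => ⟨hε, key.1 hA.negSquares⟩, fun hS => ⟨hX, key.2 hS.negSquares⟩⟩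

theorem HasNegSquares.finite_of_eq_neg_rho_inv_mul {r n : Type*} [Fintype r] [Fintype n]
    {Ω : Region} {K : ℂ → ℂ → Matrix r r ℂ} {D S : Set ℂ} {κ : ℕ} (h : HasNegSquares K D κ)
    (hD : D ⊆ Ω.carrier) (hS : S ⊆ D) {u : ℂ → r → ℂ} {y : ℂ → n → ℂ} (hy : ∀ z ∈ S, y z ≠ 0)
    (hK : ∀ ω ∈ S, ∀ l ∈ S,
      star (u l) ⬝ᵥ (K ω l *ᵥ u ω) = -((Ω.rho ω l)⁻¹ * (star (y l) ⬝ᵥ y ω))) :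
    S.Finite := by
  by_contra hinf
  let ω : Fin (κ + 1) → ℂ := fun j => Set.Infinite.natEmbedding S hinf j
  have hωS : ∀ j, ω j ∈ S := fun j => (Set.Infinite.natEmbedding S hinf j).2
  have hinj : Function.Injective ω :=
    Subtype.val_injective.comp ((Set.Infinite.natEmbedding S hinf).injective.comp Fin.val_injective)
  let Y : Matrix n (Fin (κ + 1)) ℂ := Matrix.of fun i j => star (y (ω j) i)
  have hgram : -kernelGram K ω (fun j => u (ω j)) =
      (Matrix.of fun j k => (Ω.rho (ω j) (ω k))⁻¹) ⊙ (Yᴴ * Y) := by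
    ext j k
    rw [Matrix.neg_apply, kernelGram, Matrix.of_apply, hK _ (hωS j) _ (hωS k), neg_neg]
    simp [Matrix.mul_apply, dotProduct, Y, mul_comm]
  have hdiag : ∀ j, (Yᴴ * Y) j j ≠ 0 := fun j => by
    simpa [Matrix.mul_apply, Y, dotProduct] using
      dotProduct_self_star_eq_zero.not.2 (hy _ (hωS j))
  have hneg : (-kernelGram K ω fun j => u (ω j)).PosDef :=
    hgram ▸ posDef_hadamard (Region.posDef_rho_inv (fun j => hD (hS (hωS j))) hinj)
      (Matrix.posSemidef_conjTranspose_mul_self Y) hdiag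
  have hcard := card_le_negCount (h.hermitian.gram (fun j => hS (hωS j)) fun j => u (ω j))
    (1 : Matrix (Fin (κ + 1)) (Fin (κ + 1)) ℂ) (by
      rwa [Matrix.conjTranspose_one, Matrix.one_mul, Matrix.mul_one])
  rw [Fintype.card_fin] at hcard
  exact κ.not_succ_le_self (hcard.trans (h.le _ _ _ fun j => hS (hωS j)))

section Rank

variable {p q : ℕ} {Ω : Region} {κ : ℕ} {X : ℂ → Matrix (Fin p) (Fin p ⊕ Fin q) ℂ}

theorem dotProduct_admKernel_jpq_mulVec {ω l : ℂ} {u v : Fin p → ℂ}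
    (hv : star v ᵥ* (X l).toCols₁ = 0) :
    star v ⬝ᵥ (admKernel Ω (jpq p q) X ω l *ᵥ u) =
      -((Ω.rho ω l)⁻¹ * (star ((X l).toCols₂ᴴ *ᵥ v) ⬝ᵥ ((X ω).toCols₂ᴴ *ᵥ u))) := by
  rw [admKernel, mul_jpq_mul_conjTranspose, Matrix.smul_mulVec, dotProduct_smul, Matrix.sub_mulVec,
    dotProduct_sub, ← Matrix.mulVec_mulVec, ← Matrix.mulVec_mulVec, Matrix.dotProduct_mulVec, hv,
    zero_dotProduct, zero_sub, smul_neg, smul_eq_mul, Matrix.star_mulVec,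
    Matrix.conjTranspose_conjTranspose, Matrix.dotProduct_mulVec]

theorem finite_setOf_det_toCols₁_eq_zero {D : Set ℂ} (hD : D ⊆ Ω.carrier)
    (h : HasNegSquares (admKernel Ω (jpq p q) X) D κ) :
    {z ∈ D | Function.Injective (fun v => v ᵥ* X z) ∧ (X z).toCols₁.det = 0}.Finite := by
  set S := {z ∈ D | Function.Injective (fun v => v ᵥ* X z) ∧ (X z).toCols₁.det = 0}
  have hker : ∀ z, ∃ v : Fin p → ℂ, z ∈ S → v ≠ 0 ∧ star v ᵥ* (X z).toCols₁ = 0 := by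
    intro z
    by_cases hz : z ∈ S
    · obtain ⟨v, hv, hv0⟩ := Matrix.exists_vecMul_eq_zero_iff.2 hz.2.2
      exact ⟨star v, fun _ => ⟨star_ne_zero.2 hv, by rwa [star_star]⟩⟩
    · exact ⟨0, fun h => absurd h hz⟩
  choose u hu using hker
  refine h.finite_of_eq_neg_rho_inv_mul (y := fun z => (X z).toCols₂ᴴ *ᵥ u z) hD (fun z hz => hz.1)
    (fun z hz h0 => ?_) fun ω _ l hl => dotProduct_admKernel_jpq_mulVec (hu l hl).2
  have h₂ : star (u z) ᵥ* (X z).toCols₂ = 0 := by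
    rw [← star_eq_zero, Matrix.star_vecMul, star_star, h0]
  have hX : star (u z) ᵥ* X z = 0 := by
    rw [← Matrix.fromCols_toCols (X z), Matrix.vecMul_fromCols, (hu z hz).2, h₂]
    exact Sum.elim_zero_zero
  exact (hu z hz).1 (star_eq_zero.1 (hz.2.1 (hX.trans (Matrix.zero_vecMul _).symm)))

theorem IsAdmissible.eventually_isUnit_det_toCols₁ (hX : IsAdmissible Ω (jpq p q) κ X)
    (hrank : ∀ᶠ z in codiscreteWithin Ω.carrier, Function.Injective fun v => v ᵥ* X z) :
    ∀ᶠ z in codiscreteWithin Ω.carrier, IsUnit (X z).toCols₁.det := by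
  have hfin := finite_setOf_det_toCols₁_eq_zero (fun z hz => hz.1) hX.negSquares
  filter_upwards [compl_finite_mem_codiscreteWithin hfin, hrank,
    eventually_mem_holDomain X, hX.meromorphic.eventually_matNF_eq]
    with z hz hinj hzX hNF
  refine isUnit_iff_ne_zero.2 fun h0 => hz ⟨hzX, ?_⟩
  rw [hNF]
  exact ⟨hinj, h0⟩

theorem isAdmissible_iff_exists_isGenSchur (hX : MatMeromorphicOn X Ω.carrier)
    (hrank : ∀ᶠ z in codiscreteWithin Ω.carrier, Function.Injective fun v => v ᵥ* X z) :
    IsAdmissible Ω (jpq p q) κ X ↔ ∃ ε, IsGenSchur Ω κ ε ∧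
      ∀ᶠ z in codiscreteWithin Ω.carrier, IsUnit (X z).toCols₁.det ∧
        X z = (X z).toCols₁ * Matrix.fromCols (1 : Matrix (Fin p) (Fin p) ℂ) (-(ε z)) := by
  constructor
  · intro hA
    let ε : ℂ → Matrix (Fin p) (Fin q) ℂ := fun z => -((X z).toCols₁⁻¹ * (X z).toCols₂)
    have hε : MatMeromorphicOn ε Ω.carrier := (hX.toCols₁.inv.mul hX.toCols₂).neg
    have hfac : ∀ᶠ z in codiscreteWithin Ω.carrier, IsUnit (X z).toCols₁.det ∧
        X z = (X z).toCols₁ * Matrix.fromCols (1 : Matrix (Fin p) (Fin p) ℂ) (-(ε z)) := by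
      filter_upwards [hA.eventually_isUnit_det_toCols₁ hrank] with z hz
      refine ⟨hz, ?_⟩
      rw [neg_neg, Matrix.mul_fromCols, Matrix.mul_one,
        Matrix.mul_nonsing_inv_cancel_left _ _ hz, Matrix.fromCols_toCols]
    exact ⟨ε, (isAdmissible_iff_isGenSchur hX hε hfac).1 hA, hfac⟩
  · rintro ⟨ε, hε, hfac⟩
    exact (isAdmissible_iff_isGenSchur hX hε.meromorphic hfac).2 hε

end Rank

section BlockAlgebra

variable {l m n R : Type*} [Fintype m] [DecidableEq m] [CommRing R]

theorem eq_toCols₁_mul_fromCols_one_iff {X : Matrix l (m ⊕ n) R} {ε : Matrix m n R} :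
    X = X.toCols₁ * Matrix.fromCols (1 : Matrix m m R) (-ε) ↔
      X.toCols₁ * ε + X.toCols₂ = 0 := by
  nth_rw 1 [← Matrix.fromCols_toCols X]
  rw [Matrix.mul_fromCols, Matrix.mul_one, Matrix.fromCols_ext_iff, and_iff_right rfl,
    Matrix.mul_neg, add_comm, ← eq_neg_iff_add_eq_zero]

variable [Fintype n]

theorem fromCols_one_neg_mul (s : Matrix m n R) (W : Matrix (m ⊕ n) (m ⊕ n) R) :
    Matrix.fromCols (1 : Matrix m m R) (-s) * W =
      Matrix.fromCols (W.toBlocks₁₁ - s * W.toBlocks₂₁) (W.toBlocks₁₂ - s * W.toBlocks₂₂) := by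
  conv_lhs => rw [← Matrix.fromBlocks_toBlocks W, Matrix.fromCols_mul_fromBlocks]
  simp only [Matrix.one_mul, Matrix.neg_mul, ← sub_eq_add_neg]

theorem fromCols_one_neg_mul_eq_iff {s ε : Matrix m n R} {W : Matrix (m ⊕ n) (m ⊕ n) R} :
    Matrix.fromCols (1 : Matrix m m R) (-s) * W =
        (Matrix.fromCols (1 : Matrix m m R) (-s) * W).toCols₁ *
          Matrix.fromCols (1 : Matrix m m R) (-ε) ↔
      W.toBlocks₁₁ * ε + W.toBlocks₁₂ = s * (W.toBlocks₂₁ * ε + W.toBlocks₂₂) := by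
  rw [eq_toCols₁_mul_fromCols_one_iff, fromCols_one_neg_mul, Matrix.toCols₁_fromCols,
    Matrix.toCols₂_fromCols, Matrix.sub_mul, Matrix.mul_add, Matrix.mul_assoc, sub_add_sub_comm,
    sub_eq_zero]

variable [DecidableEq n]

theorem injective_vecMul_fromCols_one_neg_mul {W : Matrix (m ⊕ n) (m ⊕ n) R} (hW : IsUnit W.det)
    (s : Matrix m n R) :
    Function.Injective fun v => v ᵥ* (Matrix.fromCols (1 : Matrix m m R) (-s) * W) := by
  intro v w h
  simp only [← Matrix.vecMul_vecMul] at h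
  have hcols := Matrix.vecMul_injective_of_isUnit ((Matrix.isUnit_iff_isUnit_det W).2 hW) h
  rw [Matrix.vecMul_fromCols, Matrix.vecMul_fromCols, Matrix.vecMul_one, Matrix.vecMul_one]
    at hcols
  exact (Sum.elim_eq_iff.1 hcols).1

theorem det_eq_det_toCols₁_mul_det {s ε : Matrix m n R} {W : Matrix (m ⊕ n) (m ⊕ n) R}
    (h : W.toBlocks₁₁ * ε + W.toBlocks₁₂ = s * (W.toBlocks₂₁ * ε + W.toBlocks₂₂)) :
    W.det = (Matrix.fromCols (1 : Matrix m m R) (-s) * W).toCols₁.det *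
      (W.toBlocks₂₁ * ε + W.toBlocks₂₂).det := by
  have htri : Matrix.fromBlocks 1 (-s) 0 1 * (W * Matrix.fromBlocks 1 ε 0 1) =
      Matrix.fromBlocks (Matrix.fromCols (1 : Matrix m m R) (-s) * W).toCols₁ 0 W.toBlocks₂₁
        (W.toBlocks₂₁ * ε + W.toBlocks₂₂) := by
    conv_lhs => rw [← Matrix.fromBlocks_toBlocks W]
    rw [fromCols_one_neg_mul, Matrix.toCols₁_fromCols, Matrix.fromBlocks_multiply,
      Matrix.fromBlocks_multiply]
    simp [h, sub_eq_add_neg]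
  simpa using congrArg Matrix.det htri

theorem isUnit_det_and_eq_mul_inv_iff {s ε : Matrix m n R} {W : Matrix (m ⊕ n) (m ⊕ n) R}
    (hW : IsUnit W.det) :
    IsUnit (W.toBlocks₂₁ * ε + W.toBlocks₂₂).det ∧
        s = (W.toBlocks₁₁ * ε + W.toBlocks₁₂) * (W.toBlocks₂₁ * ε + W.toBlocks₂₂)⁻¹ ↔
      IsUnit (Matrix.fromCols (1 : Matrix m m R) (-s) * W).toCols₁.det ∧
        Matrix.fromCols (1 : Matrix m m R) (-s) * W =
          (Matrix.fromCols (1 : Matrix m m R) (-s) * W).toCols₁ *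
            Matrix.fromCols (1 : Matrix m m R) (-ε) := by
  rw [fromCols_one_neg_mul_eq_iff]
  constructor
  · rintro ⟨hden, hs⟩
    have hnum : W.toBlocks₁₁ * ε + W.toBlocks₁₂ = s * (W.toBlocks₂₁ * ε + W.toBlocks₂₂) := by
      rw [hs, Matrix.nonsing_inv_mul_cancel_right _ _ hden]
    exact ⟨isUnit_of_mul_isUnit_left (det_eq_det_toCols₁_mul_det hnum ▸ hW), hnum⟩
  · rintro ⟨-, hnum⟩
    have hden := isUnit_of_mul_isUnit_right (det_eq_det_toCols₁_mul_det hnum ▸ hW)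
    exact ⟨hden, by rw [hnum, Matrix.mul_nonsing_inv_cancel_right _ _ hden]⟩

end BlockAlgebra

end GenSchur

theorem theorem3p3_general {Ω : Region} {p q κ : ℕ} {s : ℂ → Matrix (Fin p) (Fin q) ℂ}
    {W : ℂ → Matrix (Fin p ⊕ Fin q) (Fin p ⊕ Fin q) ℂ} (hs : MatMeromorphicOn s Ω.carrier)
    (hW : MatMeromorphicOn W Ω.carrier)
    (hdet : ∀ᶠ z in codiscreteWithin Ω.carrier, IsUnit (W z).det) :
    s ∈ lftImage Ω W κ ↔
      IsAdmissible Ω (jpq p q) κ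
        (fun z => Matrix.fromCols (1 : Matrix (Fin p) (Fin p) ℂ) (-(s z)) * W z) := by
  have hX : MatMeromorphicOn
      (fun z => Matrix.fromCols (1 : Matrix (Fin p) (Fin p) ℂ) (-(s z)) * W z) Ω.carrier :=
    ((MatMeromorphicOn.const 1).fromCols hs.neg).mul hW
  have hrank := hdet.mono fun z hz => injective_vecMul_fromCols_one_neg_mul hz (s z)
  rw [isAdmissible_iff_exists_isGenSchur hX hrank]
  exact exists_congr fun ε => and_congr_right fun _ =>
    eventually_congr (hdet.mono fun z hz => isUnit_det_and_eq_mul_inv_iff hz)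

theorem theorem3p3 (Ω : Region) (p q κ κ₁ : ℕ) (hκ : κ₁ ≤ κ)
    (s : ℂ → Matrix (Fin p) (Fin q) ℂ) (hs : IsGenSchur Ω κ s)
    (W : ℂ → Matrix (Fin p ⊕ Fin q) (Fin p ⊕ Fin q) ℂ) (hW : IsGenInner Ω κ₁ (jpq p q) W) :
    s ∈ lftImage Ω W (κ - κ₁) ↔
      IsAdmissible Ω (jpq p q) (κ - κ₁)
        (fun z => Matrix.fromCols (1 : Matrix (Fin p) (Fin p) ℂ) (-(s z)) * W z) :=
  theorem3p3_general hs.meromorphic hW.meromorphic <|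
    eventually_isUnit_det_of_boundary (Matrix.isUnit_det_of_left_inverse (jpq_mul_self p q))
      hW.meromorphic hW.boundary
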